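/- Let $k$ be an algebraically closed field of characteristic zero and $R=k((X))[Y]$. For $F\in R$ write $F_X,F_Y$ for the partial derivatives and $J(F,G)=F_XG_Y-F_YG_X$. For $F\neq 0$ of $Y$-degree $N$ with leading coefficient $F_0\in k((X))$, write $F=F_0\prod_{j=1}^{\chi}F_j$ with $F_j\in R$ monic irreducible of positive $Y$-degree $N_j$, and let $\mathrm{rad}(F)$ be $F_0$ times the product of the distinct elements among $F_1,\dots,F_\chi$. Call $F$ $k$-monic if $0\ne F_0\in k$. For an integer $\nu>0$ divisible by all $N_j$, write $F(X^\nu,Y)=F_0(X^\nu)\prod_{i=1}^N(Y-z_i(X))$ with $z_i\in k((X))$. For $F\ne0\ne G$, with $M=\deg_Y G$, put $$\mathrm{int}(F,G)=\frac{M}{\nu}\,\mathrm{ord}_X F_0(X^\nu)+\frac1\nu\sum_{i=1}^N\mathrm{ord}_X\,G(X^\nu,z_i(X))\in\mathbb Q\cup\{\infty\}$$ (with $\mathrm{ord}_X 0=\infty$), which does not depend on $\nu$; if exactly one of $F,G$ is $0$, put $\mathrm{int}(F,G)=0$ when the other lies in $k((X))$ and $\infty$ when it does not; and put $\mathrm{int}(0,0)=\infty$.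 Write $\mathrm{GCD}(F,G)=1$ to mean $\mathrm{int}(F,G)\neq\infty$. For $F$ monic irreducible, $\mathrm{res}(F,G)$ is the unique $\lambda\in k$ with $\mathrm{ord}_X(G(X^\nu,z_i(X))-\lambda)>0$ for all $i$ if such a $\lambda$ exists, and $\infty$ otherwise. For general $F\neq 0$ and $\lambda\in k$ put $\alpha_\lambda(F,G)=\{j:\mathrm{res}(F_j,G)=\lambda\}$, $\beta_\lambda(F,G)=\sum_{j\in\alpha_\lambda(F,G)}\mathrm{int}(F_j,G-\lambda)$, $\alpha(F,G)=\{\lambda\in k:\alpha_\lambda(F,G)\neq\emptyset\}$ and $$\beta(F,G)=\sum_{0\neq\lambda\in\alpha(F,G)}\beta_\lambda(F,G).$$ Theorem (beta-jacobian identity). Let $F\in R$ be $k$-monic of $Y$-degree $N$, and let $G\in R$ be such that $\mathrm{GCD}(F,G-c)=1$ for all $c\in k$. Then for $E=\mathrm{rad}(F)$ we have $$\mathrm{int}(F,J(E,G))=\mathrm{int}(F,G)+\mathrm{int}(F,E_Y)-N+\beta(F,G),$$ where each term is an integer (in particular none is $\infty$). -/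

import Mathlib

open Polynomial UniqueFactorizationMonoid

noncomputable section

namespace MeroCurve

/-- `R = k((X))[Y]`: the Laurent series variable is `X`, the polynomial variable is `Y`. -/
abbrev Curve (k : Type*) [Field k] := Polynomial (LaurentSeries k)

variable {k : Type*} [Field k]

/-- A constant of `k`, seen in `k((X))[Y]`. -/
def const (c : k) : Curve k := Polynomial.C (HahnSeries.C c)

/-- `F_X`: differentiate each coefficient with respect to `X`. -/
def derivX (F : Curve k) : Curve k :=
  ∑ i ∈ F.support, monomial i (LaurentSeries.derivative k (F.coeff i))

/-- `F_Y`. -/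
def derivY (F : Curve k) : Curve k := Polynomial.derivative F

/-- `J(F, G) = F_X G_Y - F_Y G_X`. -/
def jacobian (F G : Curve k) : Curve k := derivX F * derivY G - derivY F * derivX G

/-- `F` is `k`-monic: its leading coefficient is a nonzero element of `k`. -/
def IsKMonic (F : Curve k) : Prop :=
  ∃ c : k, c ≠ 0 ∧ F.leadingCoeff = HahnSeries.C c

/-- The irreducible monic factors `F_1, ..., F_χ` of `F`, with multiplicity. -/
def branches (F : Curve k) : Multiset (Curve k) := by
  classical exact normalizedFactors F

/-- The radical of `F`: `F_0` times the product of the distinct monic irreducible factors. -/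
def rad (F : Curve k) : Curve k := by
  classical exact Polynomial.C F.leadingCoeff * (branches F).toFinset.prod id

/-- The substitution `X ↦ X ^ ν` on `k((X))`. -/
def substPow (ν : ℕ+) : LaurentSeries k →+* LaurentSeries k :=
  HahnSeries.embDomainRingHom (AddMonoidHom.mulLeft ((ν : ℕ) : ℤ))
    (fun _ _ h => mul_left_cancel₀ (Int.natCast_ne_zero.mpr ν.ne_zero) h)
    (fun _ _ => mul_le_mul_iff_right₀ (Int.natCast_pos.mpr ν.pos))

/-- `F(X ^ ν, Y)`. -/
def substCurve (ν : ℕ+) (F : Curve k) : Curve k := F.map (substPow ν)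

theorem natDegree_pos_of_mem_branches {F P : Curve k} (h : P ∈ branches F) :
    0 < P.natDegree := by
  classical
  exact (irreducible_of_normalized_factor P h).natDegree_pos

/-- The least positive integer divisible by the `Y`-degrees of all branches of `F`. -/
def ramIndex (F : Curve k) : ℕ+ :=
  ⟨((branches F).map natDegree).lcm, Nat.pos_of_ne_zero fun h => by
    obtain ⟨P, hP, h0⟩ := Multiset.mem_map.mp ((Multiset.lcm_eq_zero_iff _).mp h)
    exact (natDegree_pos_of_mem_branches hP).ne' h0⟩

/-- The roots `z_1(X), ..., z_N(X)` in `k((X))` of `F(X ^ ν, Y)`, with multiplicity, for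
`ν = ramIndex F`. -/
def puiseuxRoots (F : Curve k) : Multiset (LaurentSeries k) :=
  (substCurve (ramIndex F) F).roots

/-- `G(X ^ ν, z(X))` for `ν = ramIndex F`. -/
def valueAt (F G : Curve k) (z : LaurentSeries k) : LaurentSeries k :=
  (substCurve (ramIndex F) G).eval z

/-- The `X`-adic order (`⊤` for the zero series), with values in `ℚ ∪ {∞}`. -/
def ordX (a : LaurentSeries k) : WithTop ℚ := a.orderTop.map (fun n : ℤ => (n : ℚ))

open Classical in
/-- The intersection multiplicity `int(F, G)`, a priori in `ℚ ∪ {∞}`. -/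
def inter (F G : Curve k) : WithTop ℚ :=
  if F ≠ 0 ∧ G ≠ 0 then
    (((G.natDegree : ℚ) / (ramIndex F : ℕ)
        * ((substPow (ramIndex F) F.leadingCoeff).order : ℚ) : ℚ) : WithTop ℚ)
      + ((puiseuxRoots F).map fun z => ordX (valueAt F G z)).sum.map
          (fun q : ℚ => q / (ramIndex F : ℕ))
  else if (F = 0 ∧ G ≠ 0 ∧ G.natDegree = 0) ∨ (G = 0 ∧ F ≠ 0 ∧ F.natDegree = 0) then 0
  else ⊤

/-- `GCD(F, G) = 1`, meaning `int(F, G) ≠ ∞`. -/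
def GcdOne (F G : Curve k) : Prop := inter F G ≠ ⊤

open Classical in
/-- The residue `res(F, G) ∈ k ∪ {∞}` of `G` at an irreducible monic `F`: the `λ ∈ k` with
`ord (G(X ^ ν, z_i(X)) - λ) > 0` for the roots `z_i` of `F(X ^ ν, Y)`, and `∞` if there is no
such `λ`. -/
def residue (F G : Curve k) : WithTop k :=
  if h : ∃ c : k, ∀ z ∈ puiseuxRoots F, 0 < ordX (valueAt F G z - HahnSeries.C c) then
    (h.choose : WithTop k)
  else ⊤

open Classical in
/-- The `λ`-alpha invariant, as the multiset of branches `F_j` of `F` with `res(F_j, G) = λ`. -/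
def alphaAt (c : k) (F G : Curve k) : Multiset (Curve k) :=
  (branches F).filter fun P => residue P G = (c : WithTop k)

/-- The `λ`-beta invariant. -/
def betaAt (c : k) (F G : Curve k) : WithTop ℚ :=
  ((alphaAt c F G).map fun P => inter P (G - const c)).sum

/-- The alpha invariant `α(F, G) ⊆ k`. -/
def alpha (F G : Curve k) : Set k := {c | alphaAt c F G ≠ 0}

theorem alpha_finite (F G : Curve k) : (alpha F G).Finite := by
  classical
  have hfin : ((fun P => residue P G) '' {P | P ∈ branches F}).Finite :=
    Set.Finite.image _ ((branches F).toFinset.finite_toSet.subset fun P hP => by simpa using hP)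
  refine (hfin.preimage (f := fun c : k => (c : WithTop k))
    (WithTop.coe_injective.injOn)).subset fun c hc => ?_
  obtain ⟨P, hP⟩ := Multiset.exists_mem_of_ne_zero hc
  exact ⟨P, (Multiset.mem_filter.mp hP).1, (Multiset.mem_filter.mp hP).2⟩

open Classical in
/-- The beta invariant: the sum of `β_λ(F, G)` over `0 ≠ λ ∈ α(F, G)`. -/
def beta (F G : Curve k) : WithTop ℚ :=
  ∑ c ∈ (alpha_finite F G).toFinset.erase 0, betaAt c F G

end MeroCurve

end

/-!
Write `θ_ν` for the substitution `X ↦ X ^ ν`. The identity is a sum of local identities, one for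
each branch of `F`.

*Reduction to branches.* By the Newton–Puiseux theorem, a monic irreducible `P ∈ k((X))[Y]` of
degree `n` has a root `z` after the substitution `θ_n`. Existence of a root after some
substitution (`exists_root_substCurve`) is by induction on the degree: after a translation in `Y`
that kills the second coefficient and a rescaling along the Newton polygon, the polynomial has
coefficients in `k[[X]]` and its reduction is not a power of a linear form, so that it factors by
the Weierstrass preparation theorem. The exponent is then controlled by the automorphisms
`rotate ζ : X ↦ ζX`, with `ζ` a root of unity: the conjugates of `z` under them are all the roots
of `P(X ^ ν, Y)` and each is a simple root (`substCurve_eq_prod_conjugates`). These automorphisms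
preserve orders, so every `H` has the same order at all roots of `P(X ^ n, Y)`, and for `F` which
is `k`-monic, `int(F, H)` is the sum over the branches `P` of `F` of the *integers*
`ord_X H(X ^ n, z(X))` (`inter_eq_sum_branches`). The residues and the beta invariant are also
sums over branches (`residue_eq_coe_iff`, `beta_eq_sum_branches`).

*The identity on a branch.* Let `P` be a branch of degree `n` with root `z`, and let
`g = G(X ^ n, z(X))`. Differentiating `E(X ^ n, z(X)) = 0` and `g`, and eliminating `z'`, gives
`n X ^ n J(E, G)(X ^ n, z) = - E_Y(X ^ n, z) · X g'` (`single_mul_valueAt_jacobian`). In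
characteristic zero `X d/dX` preserves every nonzero order. Hence `X g'` has the order of `g`
if that order is not zero; otherwise it has the order of `g - λ`, where `λ ≠ 0` is the constant
term of `g`, which is the residue of `G` along `P`, and this order is the contribution of `P` to
the beta invariant. Taking orders and summing over the branches, whose degrees add up to `N`,
gives the theorem. As `E` is squarefree, `E_Y` does not vanish at `z`, and the hypothesis on `G`
says that `g` is not a constant, so all orders are finite.
-/

noncomputable section

namespace MeroCurve

variable {k : Type*} [Field k]

/-! ### Substitutions and derivatives of Laurent series -/

theorem substPow_coeff_mul (m : ℕ+) (f : LaurentSeries k) (n : ℤ) :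
    (substPow m f).coeff (((m : ℕ) : ℤ) * n) = f.coeff n :=
  HahnSeries.embDomain_coeff

theorem substPow_coeff_of_not_dvd (m : ℕ+) (f : LaurentSeries k) {n : ℤ}
    (h : ¬ ((m : ℕ) : ℤ) ∣ n) : (substPow m f).coeff n = 0 :=
  HahnSeries.embDomain_of_notMem_range (by rintro ⟨a, rfl⟩; exact h ⟨a, rfl⟩)

theorem substPow_injective (m : ℕ+) : Function.Injective (substPow (k := k) m) :=
  RingHom.injective _

theorem substPow_C (m : ℕ+) (c : k) : substPow m (HahnSeries.C c) = HahnSeries.C c :=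
  HahnSeries.embDomainRingHom_C

theorem substPow_substPow (a b c : ℕ+) (h : (c : ℕ) = a * b) (f : LaurentSeries k) :
    substPow a (substPow b f) = substPow c f := by
  ext n
  by_cases ha : ((a : ℕ) : ℤ) ∣ n
  · obtain ⟨n, rfl⟩ := ha
    rw [substPow_coeff_mul]
    by_cases hb : ((b : ℕ) : ℤ) ∣ n
    · obtain ⟨n, rfl⟩ := hb
      rw [substPow_coeff_mul, ← mul_assoc, ← Nat.cast_mul, ← h, substPow_coeff_mul]
    · rw [substPow_coeff_of_not_dvd _ _ hb, substPow_coeff_of_not_dvd]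
      rw [h, Nat.cast_mul]
      exact fun hd => hb (Int.dvd_of_mul_dvd_mul_left (by simp) hd)
  · rw [substPow_coeff_of_not_dvd _ _ ha, substPow_coeff_of_not_dvd]
    exact fun hd => ha ((Dvd.intro _ (by rw [h, Nat.cast_mul])).trans hd)

theorem orderTop_substPow (m : ℕ+) (f : LaurentSeries k) :
    (substPow m f).orderTop = f.orderTop.map (fun n => ((m : ℕ) : ℤ) * n) :=
  HahnSeries.orderTop_embDomain

/-- The `k`-linear map `∑ fₙ Xⁿ ↦ ∑ a n fₙ Xⁿ` on Laurent series. -/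
def coeffScale (a : ℤ → k) : LaurentSeries k →ₗ[k] LaurentSeries k where
  toFun f := ⟨fun n => a n * f.coeff n, f.isPWO_support.mono fun n hn h => hn (by simp [h])⟩
  map_add' f g := by ext; simp [mul_add]
  map_smul' c f := by ext; simp [mul_left_comm]

@[simp]
theorem coeffScale_coeff (a : ℤ → k) (f : LaurentSeries k) (n : ℤ) :
    (coeffScale a f).coeff n = a n * f.coeff n := rfl

theorem support_coeffScale_subset (a : ℤ → k) (f : LaurentSeries k) :
    (coeffScale a f).support ⊆ f.support := fun n hn h => hn (by simp [h])

/-- The sum defining a coefficient of a product of scaled series may be taken over the supports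
of the series before scaling. -/
theorem coeffScale_mul_coeffScale_coeff (a b : ℤ → k) (f g : LaurentSeries k) (n : ℤ) :
    (coeffScale a f * coeffScale b g).coeff n =
      ∑ ij ∈ Finset.antidiagonal f.isPWO_support g.isPWO_support n,
        a ij.1 * f.coeff ij.1 * (b ij.2 * g.coeff ij.2) := by
  rw [HahnSeries.coeff_mul]
  refine Finset.sum_subset (fun ij h => ?_) fun ij h h' => ?_
  · simp only [Finset.mem_antidiagonal] at h ⊢
    exact ⟨support_coeffScale_subset _ _ h.1, support_coeffScale_subset _ _ h.2.1, h.2.2⟩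
  · simp only [Finset.mem_antidiagonal, not_and, HahnSeries.mem_support, ne_eq] at h h'
    by_contra hne
    exact h' (fun h0 => hne (by simp_all)) (fun h0 => hne (by simp_all)) h.2.2

/-- The automorphism `f(X) ↦ f(cX)` of `k((X))`, for a nonzero constant `c`. -/
def rotate (c : kˣ) : LaurentSeries k →+* LaurentSeries k where
  toFun := coeffScale fun n => ((c ^ n : kˣ) : k)
  map_one' := by
    ext n
    by_cases h : n = 0 <;> simp [HahnSeries.coeff_one, h]
  map_zero' := map_zero _
  map_add' := map_add _
  map_mul' f g := by
    ext n
    rw [coeffScale_mul_coeffScale_coeff, coeffScale_coeff, HahnSeries.coeff_mul, Finset.mul_sum]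
    refine Finset.sum_congr rfl fun ij h => ?_
    rw [← (Finset.mem_antidiagonal.mp h).2.2, zpow_add, Units.val_mul]
    ring

@[simp]
theorem rotate_coeff (c : kˣ) (f : LaurentSeries k) (n : ℤ) :
    (rotate c f).coeff n = ((c ^ n : kˣ) : k) * f.coeff n := rfl

theorem rotate_substPow (c : kˣ) (m : ℕ+) (hc : c ^ (m : ℕ) = 1) (f : LaurentSeries k) :
    rotate c (substPow m f) = substPow m f := by
  ext n
  by_cases h : ((m : ℕ) : ℤ) ∣ n
  · obtain ⟨n, rfl⟩ := h
    simp [zpow_mul, hc]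
  · simp [substPow_coeff_of_not_dvd _ _ h]

theorem orderTop_rotate (c : kˣ) (f : LaurentSeries k) :
    (rotate c f).orderTop = f.orderTop := by
  have : ∀ n, (rotate c f).coeff n = 0 ↔ f.coeff n = 0 := fun n => by
    rw [rotate_coeff, Units.mul_right_eq_zero]
  refine le_antisymm ?_ ?_ <;> rw [HahnSeries.le_orderTop_iff_forall]
  · exact fun n hn => (this n).1 (HahnSeries.coeff_eq_zero_of_lt_orderTop hn)
  · exact fun n hn => (this n).2 (HahnSeries.coeff_eq_zero_of_lt_orderTop hn)

/-- A series supported on the multiples of `m` is a series in `X ^ m`. -/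
theorem mem_range_substPow (m : ℕ+) (f : LaurentSeries k)
    (h : ∀ n, f.coeff n ≠ 0 → ((m : ℕ) : ℤ) ∣ n) : f ∈ (substPow m).range := by
  have hm : (0 : ℤ) < (m : ℕ) := Int.natCast_pos.mpr m.pos
  refine ⟨HahnSeries.ofSuppBddBelow (fun n => f.coeff (((m : ℕ) : ℤ) * n))
    ⟨min f.order 0, ?_⟩, ?_⟩
  · intro n hn
    have h1 : f.order ≤ ((m : ℕ) : ℤ) * n := HahnSeries.order_le_of_coeff_ne_zero hn
    by_contra! h2
    obtain ⟨h3, h4⟩ := lt_min_iff.1 h2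
    nlinarith
  · ext n
    by_cases hd : ((m : ℕ) : ℤ) ∣ n
    · obtain ⟨n, rfl⟩ := hd
      rw [substPow_coeff_mul]
      rfl
    · rw [substPow_coeff_of_not_dvd _ _ hd]
      by_contra h0
      exact hd (h n (Ne.symm h0))

/-- A series fixed by `X ↦ ζX`, for a primitive `m`-th root of unity `ζ`, is a series in
`X ^ m`. -/
theorem mem_range_substPow_of_rotate (m : ℕ+) (c : kˣ) (hc : IsPrimitiveRoot c m)
    (f : LaurentSeries k) (h : rotate c f = f) : f ∈ (substPow m).range := by
  refine mem_range_substPow m f fun n hn => ?_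
  have h1 := congrArg (fun g => HahnSeries.coeff g n) h
  simp only [rotate_coeff, mul_eq_right₀ hn, Units.val_eq_one] at h1
  exact (hc.zpow_eq_one_iff_dvd n).1 h1

theorem derivative_coeff (f : LaurentSeries k) (n : ℤ) :
    (LaurentSeries.derivative k f).coeff n = ((n + 1 : ℤ) : k) * f.coeff (n + 1) := by
  simp [LaurentSeries.derivative_apply, LaurentSeries.hasseDeriv_coeff]

/-- `X · d/dX` multiplies the `n`-th coefficient by `n`. -/
theorem single_one_mul_derivative (f : LaurentSeries k) :
    HahnSeries.single 1 1 * LaurentSeries.derivative k f = coeffScale (fun n => (n : k)) f := by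
  ext n
  have := HahnSeries.coeff_single_mul_add (r := (1 : k)) (x := LaurentSeries.derivative k f)
    (a := n - 1) (b := 1)
  rw [sub_add_cancel] at this
  rw [this, derivative_coeff]
  simp

theorem derivative_mul (f g : LaurentSeries k) :
    LaurentSeries.derivative k (f * g) =
      f * LaurentSeries.derivative k g + g * LaurentSeries.derivative k f := by
  have hX : (HahnSeries.single 1 1 : LaurentSeries k) ≠ 0 := by simp
  refine mul_left_cancel₀ hX ?_
  rw [mul_add, mul_left_comm _ f, mul_left_comm _ g, single_one_mul_derivative,
    single_one_mul_derivative, single_one_mul_derivative, mul_comm g]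
  have h1 : ∀ f : LaurentSeries k, coeffScale (fun _ => (1 : k)) f = f := fun f => by ext; simp
  ext n
  have e1 := coeffScale_mul_coeffScale_coeff (fun _ => (1 : k)) (fun n => (n : k)) f g n
  have e2 := coeffScale_mul_coeffScale_coeff (fun n => (n : k)) (fun _ => (1 : k)) f g n
  rw [h1] at e1 e2
  rw [HahnSeries.coeff_add, e1, e2, coeffScale_coeff, HahnSeries.coeff_mul, Finset.mul_sum,
    ← Finset.sum_add_distrib]
  refine Finset.sum_congr rfl fun ij h => ?_
  rw [← (Finset.mem_antidiagonal.mp h).2.2]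
  push_cast
  ring

theorem derivative_C (c : k) :
    LaurentSeries.derivative k (HahnSeries.C c : LaurentSeries k) = 0 := by
  ext n
  rw [derivative_coeff]
  by_cases h : n + 1 = 0
  · simp [h]
  · simp [HahnSeries.C_apply, HahnSeries.coeff_single_of_ne h]

theorem derivative_pow (f : LaurentSeries k) (n : ℕ) :
    LaurentSeries.derivative k (f ^ n) = n * f ^ (n - 1) * LaurentSeries.derivative k f := by
  induction n with
  | zero =>
    have := derivative_C (1 : k)
    simpa using this
  | succ n ih =>
    rw [pow_succ, derivative_mul, ih]
    rcases n with _ | n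
    · simp
    · simp only [Nat.add_sub_cancel, pow_succ]
      push_cast
      ring

/-- The chain rule for the substitution `X ↦ X ^ m`. -/
theorem single_one_mul_derivative_substPow (m : ℕ+) (f : LaurentSeries k) :
    HahnSeries.single 1 1 * LaurentSeries.derivative k (substPow m f) =
      HahnSeries.single ((m : ℕ) : ℤ) ((m : ℕ) : k) *
        substPow m (LaurentSeries.derivative k f) := by
  have hs : (HahnSeries.single ((m : ℕ) : ℤ) ((m : ℕ) : k) : LaurentSeries k) =
      HahnSeries.C ((m : ℕ) : k) * substPow m (HahnSeries.single 1 1) := by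
    have : substPow m (HahnSeries.single 1 (1 : k)) =
        HahnSeries.single (((m : ℕ) : ℤ) * 1) (1 : k) := HahnSeries.embDomain_single
    rw [this, HahnSeries.C_apply, HahnSeries.single_mul_single]
    simp
  rw [hs, mul_assoc, ← map_mul, single_one_mul_derivative, single_one_mul_derivative]
  ext n
  rw [HahnSeries.C_mul_eq_smul, HahnSeries.coeff_smul, coeffScale_coeff]
  by_cases hd : ((m : ℕ) : ℤ) ∣ n
  · obtain ⟨n, rfl⟩ := hd
    rw [substPow_coeff_mul, substPow_coeff_mul, coeffScale_coeff]
    push_cast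
    rw [smul_eq_mul, mul_assoc]
  · simp [substPow_coeff_of_not_dvd _ _ hd]

theorem derivX_coeff (F : Curve k) (n : ℕ) :
    (derivX F).coeff n = LaurentSeries.derivative k (F.coeff n) := by
  rw [derivX, finsetSum_coeff]
  simp only [coeff_monomial, Finset.sum_ite_eq']
  split_ifs with h
  · rfl
  · rw [notMem_support_iff.1 h, map_zero]

theorem derivX_add (F G : Curve k) : derivX (F + G) = derivX F + derivX G := by
  ext1 n
  simp [derivX_coeff]

theorem derivX_monomial (n : ℕ) (a : LaurentSeries k) :
    derivX (monomial n a) = monomial n (LaurentSeries.derivative k a) := by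
  ext1 m
  simp only [derivX_coeff, coeff_monomial]
  split_ifs <;> simp

/-- The chain rule for `F(X, z(X))`. -/
theorem derivative_eval (F : Curve k) (z : LaurentSeries k) :
    LaurentSeries.derivative k (F.eval z) =
      (derivX F).eval z + (derivY F).eval z * LaurentSeries.derivative k z := by
  induction F using Polynomial.induction_on' with
  | add p q hp hq =>
    rw [eval_add, map_add, hp, hq, derivX_add, derivY, derivY, derivY, derivative_add,
      eval_add, eval_add]
    ring
  | monomial n a =>
    rw [derivX_monomial, derivY, derivative_monomial, eval_monomial, eval_monomial, eval_monomial,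
      derivative_mul, derivative_pow]
    ring

theorem single_mul_derivX_substCurve (m : ℕ+) (F : Curve k) :
    C (HahnSeries.single 1 1) * derivX (substCurve m F) =
      C (HahnSeries.single ((m : ℕ) : ℤ) ((m : ℕ) : k)) * substCurve m (derivX F) := by
  ext1 n
  rw [coeff_C_mul, coeff_C_mul, derivX_coeff, substCurve, substCurve, coeff_map, coeff_map,
    single_one_mul_derivative_substPow, derivX_coeff]

/-- In characteristic zero, `X · d/dX` preserves a nonzero order. -/
theorem orderTop_single_one_mul_derivative [CharZero k] (f : LaurentSeries k) (n : ℤ)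
    (hf : f.orderTop = (n : WithTop ℤ)) (hn : n ≠ 0) :
    (HahnSeries.single 1 1 * LaurentSeries.derivative k f : LaurentSeries k).orderTop =
      (n : WithTop ℤ) := by
  rw [single_one_mul_derivative]
  refine le_antisymm (HahnSeries.orderTop_le_of_coeff_ne_zero ?_) ?_
  · rw [coeffScale_coeff]
    exact mul_ne_zero (Int.cast_ne_zero.2 hn) (HahnSeries.coeff_orderTop_ne hf)
  · rw [HahnSeries.le_orderTop_iff_forall]
    intro i hi
    rw [coeffScale_coeff, HahnSeries.coeff_eq_zero_of_lt_orderTop (hf ▸ hi), mul_zero]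

/-! ### The Newton–Puiseux theorem -/

instance isAdicComplete_maximalIdeal_powerSeries :
    IsAdicComplete (IsLocalRing.maximalIdeal (PowerSeries k)) (PowerSeries k) := by
  rw [PowerSeries.maximalIdeal_eq_span_X]
  infer_instance

theorem residue_eq_zero_iff_constantCoeff (a : PowerSeries k) :
    IsLocalRing.residue (PowerSeries k) a = 0 ↔ PowerSeries.constantCoeff a = 0 := by
  rw [IsLocalRing.residue_eq_zero_iff, PowerSeries.maximalIdeal_eq_span_X,
    Ideal.mem_span_singleton, PowerSeries.X_dvd_iff]

/-- The distinguished factor of a polynomial in the ring of power series divides it in the ring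
of polynomials. -/
theorem dvd_of_isWeierstrassFactorization {A : Type*} [CommRing A] [IsLocalRing A]
    [IsAdicComplete (IsLocalRing.maximalIdeal A) A] {P f : A[X]} {h : PowerSeries A}
    (H : (P : PowerSeries A).IsWeierstrassFactorization f h) : f ∣ P := by
  rw [← Ideal.mem_span_singleton, ← Ideal.Quotient.eq_zero_iff_mem]
  apply H.algEquivQuotient.injective
  rw [map_zero]
  simp

/-- A case of Hensel's lemma, read off from the Weierstrass preparation theorem: if `0` is a root
of the reduction of `P` but not its only root, then the distinguished factor of `P` is a proper
polynomial factor. -/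
theorem exists_monic_factor_of_residue {A : Type*} [CommRing A] [IsLocalRing A]
    [IsAdicComplete (IsLocalRing.maximalIdeal A) A] (P : A[X])
    (h0 : IsLocalRing.residue A (P.coeff 0) = 0) (i : ℕ) (hi : i < P.natDegree)
    (hci : IsLocalRing.residue A (P.coeff i) ≠ 0) :
    ∃ f : A[X], f ∣ P ∧ f.Monic ∧ 0 < f.natDegree ∧ f.natDegree < P.natDegree := by
  set g : PowerSeries A := (P : PowerSeries A) with hgdef
  have hcoef : ∀ j, PowerSeries.coeff j (g.map (IsLocalRing.residue A)) =
      IsLocalRing.residue A (P.coeff j) := fun j => by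
    rw [PowerSeries.coeff_map, hgdef, coeff_coe]
  have hg : g.map (IsLocalRing.residue A) ≠ 0 := fun h =>
    hci (by rw [← hcoef, h, map_zero])
  obtain ⟨f, h, H⟩ := g.exists_isWeierstrassFactorization hg
  have hdeg := H.natDegree_eq_toNat_order_map
  have hord := ENat.natCast_toNat (PowerSeries.order_finite_iff_ne_zero.2 hg).ne
  rw [← hdeg] at hord
  refine ⟨f, dvd_of_isWeierstrassFactorization H, H.isDistinguishedAt.monic,
    Nat.pos_of_ne_zero fun hz => ?_, ?_⟩
  · exact PowerSeries.coeff_order hg (by rw [← hdeg, hz, hcoef, h0])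
  · refine lt_of_le_of_lt ?_ hi
    have := PowerSeries.order_le i (fun h => hci ((hcoef i).symm.trans h))
    rw [← hord] at this
    exact_mod_cast this

/-- A polynomial over `k[[X]]` with vanishing second coefficient whose reduction is not a power of
`Y` has a proper factor: its reduction has a root, which cannot be the only one because the sum of
the roots is zero. -/
theorem exists_monic_factor_of_depressed [IsAlgClosed k] [CharZero k] (P : (PowerSeries k)[X])
    (hP : P.Monic) (hn : 0 < P.natDegree) (h1 : P.coeff (P.natDegree - 1) = 0) (j : ℕ)
    (hj : j < P.natDegree) (hcj : PowerSeries.constantCoeff (P.coeff j) ≠ 0) :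
    ∃ f : (PowerSeries k)[X], f ∣ P ∧ f.Monic ∧ 0 < f.natDegree ∧ f.natDegree < P.natDegree := by
  set φ : PowerSeries k →+* k := PowerSeries.constantCoeff
  have hPm : (P.map φ).Monic := hP.map φ
  have hdeg : (P.map φ).natDegree = P.natDegree := hP.natDegree_map φ
  obtain ⟨c, hc⟩ := IsAlgClosed.exists_root (P.map φ) (by
    rw [degree_eq_natDegree hPm.ne_zero, hdeg]
    exact_mod_cast hn.ne')
  set a : PowerSeries k := PowerSeries.C c
  have ha : φ a = c := PowerSeries.constantCoeff_C c
  have hQm : (taylor a P).Monic := by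
    rw [Monic, leadingCoeff_taylor]; exact hP
  have hmap : (taylor a P).map φ = taylor c (P.map φ) := by
    rw [← ha, map_taylor]
  have h0 : φ ((taylor a P).coeff 0) = 0 := by
    rw [← coeff_map, hmap, taylor_coeff_zero]; exact hc
  have hex : ∃ i < (taylor a P).natDegree, φ ((taylor a P).coeff i) ≠ 0 := by
    by_contra! hcon
    rw [natDegree_taylor] at hcon
    have hX : taylor c (P.map φ) = X ^ P.natDegree := by
      rw [← hmap]
      ext i
      rw [coeff_map, coeff_X_pow]
      rcases lt_trichotomy i P.natDegree with h | h | h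
      · rw [hcon i h, if_neg h.ne]
      · rw [if_pos h, h]
        have := hQm.coeff_natDegree
        rw [natDegree_taylor] at this
        rw [this, map_one]
      · rw [if_neg h.ne', coeff_eq_zero_of_natDegree_lt (by rwa [natDegree_taylor]), map_zero]
    have hX' : P.map φ = (X + C (-c)) ^ P.natDegree := by
      have := congrArg (taylor (-c)) hX
      rw [taylor_taylor, neg_add_cancel, taylor_zero, taylor_pow, taylor_X] at this
      exact this
    have hc0 : c = 0 := by
      have := congrArg (fun p => p.coeff (P.natDegree - 1)) hX'
      simp only [coeff_map, h1, map_zero] at this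
      rw [coeff_X_add_C_pow, Nat.sub_sub_self hn, pow_one, Nat.choose_symm hn, Nat.choose_one_right]
        at this
      have h2 := mul_eq_zero.1 this.symm
      simpa [hn.ne'] using h2
    apply hcj
    rw [← coeff_map, hX', hc0]
    simp [coeff_X_pow, hj.ne]
  obtain ⟨i, hi, hci⟩ := hex
  obtain ⟨f, hd, hf, hf0, hfn⟩ := exists_monic_factor_of_residue (taylor a P)
    ((residue_eq_zero_iff_constantCoeff _).2 h0) i hi
    (mt (residue_eq_zero_iff_constantCoeff _).1 hci)
  refine ⟨taylor (-a) f, ?_, ?_, ?_, ?_⟩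
  · obtain ⟨h, hh⟩ := hd
    refine ⟨taylor (-a) h, ?_⟩
    rw [← taylor_mul, ← hh, taylor_taylor, neg_add_cancel, taylor_zero]
  · rw [Monic, leadingCoeff_taylor]; exact hf
  · rwa [natDegree_taylor]
  · rwa [natDegree_taylor, ← natDegree_taylor P a]

theorem mem_range_ofPowerSeries (f : LaurentSeries k) (hf : 0 ≤ f.orderTop) :
    f ∈ (HahnSeries.ofPowerSeries ℤ k).range := by
  refine ⟨PowerSeries.mk fun n => f.coeff n, ?_⟩
  ext n
  rw [PowerSeries.coeff_coe]
  split_ifs with h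
  · exact (HahnSeries.coeff_eq_zero_of_lt_orderTop (lt_of_lt_of_le (by exact_mod_cast h) hf)).symm
  · rw [PowerSeries.coeff_mk, Int.natAbs_of_nonneg (not_lt.1 h)]

theorem charZero_laurentSeries [CharZero k] : CharZero (LaurentSeries k) :=
  charZero_of_injective_ringHom (HahnSeries.C_injective (Γ := ℤ) (R := k))

theorem substCurve_substCurve (a b c : ℕ+) (h : (c : ℕ) = a * b) (F : Curve k) :
    substCurve a (substCurve b F) = substCurve c F := by
  ext1 n
  simp only [substCurve, coeff_map, substPow_substPow a b c h]

/-- The induction step of the Newton–Puiseux theorem, for a polynomial with vanishing second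
coefficient. -/
theorem exists_root_substCurve_of_depressed [IsAlgClosed k] [CharZero k] (P : Curve k)
    (hP : P.Monic) (hn : 0 < P.natDegree) (h1 : P.coeff (P.natDegree - 1) = 0)
    (ih : ∀ Q : Curve k, Q.Monic → 0 < Q.natDegree → Q.natDegree < P.natDegree →
      ∃ (m : ℕ+) (z : LaurentSeries k), (substCurve m Q).eval z = 0) :
    ∃ (m : ℕ+) (z : LaurentSeries k), (substCurve m P).eval z = 0 := by
  classical
  set n := P.natDegree with hndef
  set S := (Finset.range n).filter fun j => P.coeff j ≠ 0 with hS
  rcases S.eq_empty_or_nonempty with hSe | hSn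
  · refine ⟨1, 0, ?_⟩
    rw [← coeff_zero_eq_eval_zero, substCurve, coeff_map]
    by_contra hne
    have : 0 ∈ S := Finset.mem_filter.2 ⟨Finset.mem_range.2 hn, fun h => hne (by rw [h, map_zero])⟩
    simp [hSe] at this
  let ν : ℕ+ := ⟨n.factorial, n.factorial_pos⟩
  let e : ℕ → ℤ := fun j => ((n.factorial / (n - j) : ℕ) : ℤ) * (P.coeff j).order
  -- The exponent `n!` makes all slopes of the Newton polygon integral: after `X ↦ X ^ n!` the
  -- `j`-th coefficient has order `(n - j) * e j`.
  have he : ∀ j < n, ((n - j : ℕ) : ℤ) * e j = ((ν : ℕ) : ℤ) * (P.coeff j).order := fun j hj => by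
    have : (n - j) * (n.factorial / (n - j)) = n.factorial :=
      Nat.mul_div_cancel' (Nat.dvd_factorial (by omega) (by omega))
    simp only [e, ← mul_assoc, ← Nat.cast_mul, this]
    rfl
  -- The scaling by `X ^ (-e j₀)` for the least `e j₀` makes all coefficients integral, with the
  -- `j₀`-th one a unit.
  obtain ⟨j₀, hj₀, hmin⟩ := S.exists_min_image e hSn
  set s : LaurentSeries k := HahnSeries.single (-e j₀) 1 with hs
  have hs0 : s ≠ 0 := by simp [hs]
  set Q := (substCurve ν P).scaleRoots s with hQ
  have hdegν : (substCurve ν P).natDegree = n := hP.natDegree_map _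
  have hQm : Q.Monic := (monic_scaleRoots_iff s).2 (hP.map _)
  have hQdeg : Q.natDegree = n := by rw [hQ, natDegree_scaleRoots, hdegν]
  have hQc : ∀ j < n, P.coeff j ≠ 0 →
      (Q.coeff j).orderTop = (((n - j : ℕ) : ℤ) * (e j - e j₀) : ℤ) := fun j hj hne => by
    have hsp : s ^ (n - j) = HahnSeries.single (((n - j : ℕ) : ℤ) * (-e j₀)) 1 := by
      rw [hs, HahnSeries.single_pow, one_pow, nsmul_eq_mul]
    rw [hQ, coeff_scaleRoots, hdegν, substCurve, coeff_map, HahnSeries.orderTop_mul, hsp,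
      HahnSeries.orderTop_single one_ne_zero, orderTop_substPow,
      ← HahnSeries.order_eq_orderTop_of_ne_zero hne, WithTop.map_coe, ← he j hj, ← WithTop.coe_add]
    congr 1
    ring
  have hQ0 : ∀ j, P.coeff j = 0 → Q.coeff j = 0 := fun j h => by
    rw [hQ, coeff_scaleRoots, substCurve, coeff_map, h, map_zero, zero_mul]
  have hlift : Q ∈ lifts (HahnSeries.ofPowerSeries ℤ k) := by
    rw [lifts_iff_coeff_lifts]
    intro j
    refine mem_range_ofPowerSeries _ ?_
    by_cases hz : P.coeff j = 0
    · rw [hQ0 j hz, HahnSeries.orderTop_zero]; exact le_top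
    rcases lt_trichotomy j n with hj | hj | hj
    · rw [hQc j hj hz]
      have := hmin j (Finset.mem_filter.2 ⟨Finset.mem_range.2 hj, hz⟩)
      exact_mod_cast mul_nonneg (Int.natCast_nonneg _) (sub_nonneg.2 this)
    · rw [hj, ← hQdeg, hQm.coeff_natDegree, HahnSeries.orderTop_one]
    · exact absurd (coeff_eq_zero_of_natDegree_lt hj) hz
  obtain ⟨T, hTmap, hTdeg, hTm⟩ := lifts_and_natDegree_eq_and_monic hlift hQm
  rw [hQdeg] at hTdeg
  have hTinj : Function.Injective (HahnSeries.ofPowerSeries ℤ k) :=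
    HahnSeries.ofPowerSeries_injective
  have hTc : ∀ j, HahnSeries.ofPowerSeries ℤ k (T.coeff j) = Q.coeff j := fun j => by
    rw [← hTmap, coeff_map]
  obtain ⟨hj₀n, hj₀0⟩ := Finset.mem_filter.1 hj₀
  obtain ⟨f, hfd, hfm, hf0, hfn⟩ := exists_monic_factor_of_depressed T hTm (hTdeg ▸ hn)
    (by
      apply hTinj
      rw [hTc, hTdeg, hQ0 _ h1, map_zero])
    j₀ (hTdeg ▸ Finset.mem_range.1 hj₀n) (by
      have h2 := HahnSeries.coeff_orderTop_ne (hQc j₀ (Finset.mem_range.1 hj₀n) hj₀0)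
      rw [sub_self, mul_zero, ← hTc, PowerSeries.coeff_coe] at h2
      simpa using h2)
  obtain ⟨m, z, hz⟩ := ih (f.map (HahnSeries.ofPowerSeries ℤ k)) (hfm.map _)
    (by rwa [hfm.natDegree_map]) (by rw [hfm.natDegree_map]; omega)
  have hQz : (substCurve m Q).eval z = 0 := by
    obtain ⟨h, hh⟩ := hfd
    rw [← hTmap, hh, Polynomial.map_mul, substCurve, Polynomial.map_mul, eval_mul]
    rw [substCurve] at hz
    rw [hz, zero_mul]
  have hs1 : substPow m s ≠ 0 := (_root_.map_ne_zero _).2 hs0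
  refine ⟨m * ν, z / substPow m s, ?_⟩
  rw [← substCurve_substCurve m ν (m * ν) rfl]
  have h3 : substCurve m Q = (substCurve m (substCurve ν P)).scaleRoots (substPow m s) := by
    rw [hQ, substCurve, map_scaleRoots]
    · rfl
    · have : (substCurve ν P).leadingCoeff = 1 := hP.map (substPow ν)
      rw [this, map_one]; exact one_ne_zero
  rw [h3, ← mul_div_cancel₀ z hs1, scaleRoots_eval_mul] at hQz
  exact (mul_eq_zero.1 hQz).resolve_left (pow_ne_zero _ hs1)

theorem coeff_taylor_natDegree_sub_one {R : Type*} [CommRing R] (P : R[X]) (a : R)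
    (hn : 0 < P.natDegree) :
    (taylor a P).coeff (P.natDegree - 1) =
      P.coeff (P.natDegree - 1) + P.natDegree * P.leadingCoeff * a := by
  have h : hasseDeriv (P.natDegree - 1) P =
      C (P.coeff (P.natDegree - 1)) + C (P.natDegree * P.leadingCoeff) * X := by
    ext i
    rw [hasseDeriv_coeff]
    rcases i with _ | _ | i
    · simp
    · have : 0 + 1 + (P.natDegree - 1) = P.natDegree := by omega
      rw [this, Nat.choose_symm hn, Nat.choose_one_right]
      simp
    · rw [coeff_eq_zero_of_natDegree_lt (by omega)]
      simp
  rw [taylor_coeff, h]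
  simp

/-- Newton–Puiseux: after some substitution `X ↦ X ^ m` a polynomial of positive degree over
`k((X))` acquires a root. -/
theorem exists_root_substCurve [IsAlgClosed k] [CharZero k] (P : Curve k)
    (hP : P.Monic) (hn : 0 < P.natDegree) :
    ∃ (m : ℕ+) (z : LaurentSeries k), (substCurve m P).eval z = 0 := by
  induction hd : P.natDegree using Nat.strong_induction_on generalizing P with
  | _ n ih =>
  have := charZero_laurentSeries (k := k)
  -- Translate so that the sum of the roots becomes zero.
  set a : LaurentSeries k := - P.coeff (P.natDegree - 1) / P.natDegree
  obtain ⟨m, z, hz⟩ := exists_root_substCurve_of_depressed (taylor a P)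
    (by rw [Monic, leadingCoeff_taylor]; exact hP) (by rwa [natDegree_taylor]) (by
      rw [natDegree_taylor, coeff_taylor_natDegree_sub_one P a hn, hP.leadingCoeff]
      have : ((P.natDegree : ℕ) : LaurentSeries k) ≠ 0 := Nat.cast_ne_zero.2 hn.ne'
      rw [mul_one, mul_div_cancel₀ _ this, add_neg_cancel])
    (fun Q hQ h0 hlt => ih Q.natDegree (by rwa [natDegree_taylor, hd] at hlt) Q hQ h0 rfl)
  refine ⟨m, z + substPow m a, ?_⟩
  rw [substCurve, map_taylor, taylor_eval] at hz
  exact hz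

/-! ### Branches and intersection multiplicities -/

theorem rotate_one (f : LaurentSeries k) : rotate 1 f = f := by
  ext n
  simp

theorem rotate_iterate (c : kˣ) (i : ℕ) (f : LaurentSeries k) :
    (rotate c)^[i] f = rotate (c ^ i) f := by
  induction i with
  | zero => rw [pow_zero, rotate_one, Function.iterate_zero_apply]
  | succ i ih =>
    rw [Function.iterate_succ_apply', ih]
    ext n
    simp only [rotate_coeff, ← mul_assoc, ← Units.val_mul, ← mul_zpow, pow_succ']

theorem substCurve_eval_rotate (c : kˣ) (m : ℕ+) (hc : c ^ (m : ℕ) = 1) (H : Curve k)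
    (z : LaurentSeries k) :
    (substCurve m H).eval (rotate c z) = rotate c ((substCurve m H).eval z) := by
  have : (substCurve m H).map (rotate c) = substCurve m H := by
    ext1 n
    simp only [substCurve, coeff_map, rotate_substPow c m hc]
  conv_lhs => rw [← this]
  rw [eval_map_apply]

theorem substCurve_eval_substPow (a b c : ℕ+) (h : (c : ℕ) = a * b) (H : Curve k)
    (z : LaurentSeries k) :
    (substCurve c H).eval (substPow a z) = substPow a ((substCurve b H).eval z) := by
  rw [← substCurve_substCurve a b c h, substCurve, eval_map_apply]

/-- Galois descent along `X ↦ X ^ m`: for `P` irreducible, the conjugates `z(ζⁱX)` of one root of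
`P(X ^ m, Y)` are all its roots, without repetition. -/
theorem substCurve_eq_prod_conjugates {P : Curve k} (hP : Irreducible P) (hm : P.Monic) (m : ℕ+)
    (ζ : kˣ) (hζ : IsPrimitiveRoot ζ m) (z : LaurentSeries k) (hz : (substCurve m P).eval z = 0) :
    substCurve m P = ∏ i ∈ Finset.range (Function.minimalPeriod (rotate ζ) z),
      (X - C ((rotate ζ)^[i] z)) := by
  classical
  set d := Function.minimalPeriod (rotate ζ) z with hd
  have hper : Function.IsPeriodicPt (rotate ζ) m z := by
    rw [Function.IsPeriodicPt, Function.IsFixedPt, rotate_iterate, hζ.pow_eq_one, rotate_one]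
  have hd0 : 0 < d := hper.minimalPeriod_pos m.pos
  have hinj : Set.InjOn (fun i => (rotate ζ)^[i] z) (Finset.range d) := by
    have := Function.iterate_injOn_Iio_minimalPeriod (f := rotate ζ) (x := z)
    intro i hi j hj h
    exact this (by simpa using hi) (by simpa using hj) h
  set O : Finset (LaurentSeries k) := (Finset.range d).image fun i => (rotate ζ)^[i] z with hO
  have hprod : ∏ i ∈ Finset.range d, (X - C ((rotate ζ)^[i] z)) = ∏ w ∈ O, (X - C w) := by
    rw [hO, Finset.prod_image hinj]
  rw [hprod]
  set Q := ∏ w ∈ O, (X - C w) with hQ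
  have hOmem : ∀ i, (rotate ζ)^[i] z ∈ O := fun i => by
    rw [← Function.iterate_mod_minimalPeriod_eq]
    exact Finset.mem_image_of_mem _ (Finset.mem_range.2 (Nat.mod_lt _ hd0))
  have hOimg : O.image (rotate ζ) = O := by
    refine Finset.eq_of_subset_of_card_le ?_ (Finset.card_image_of_injective _
      (RingHom.injective _)).ge
    intro w hw
    obtain ⟨v, hv, rfl⟩ := Finset.mem_image.1 hw
    obtain ⟨i, -, rfl⟩ := Finset.mem_image.1 hv
    rw [← Function.iterate_succ_apply' (rotate ζ)]
    exact hOmem _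
  have hQmonic : Q.Monic := monic_prod_of_monic _ _ fun w _ => monic_X_sub_C w
  have hQfix : Q.map (rotate ζ) = Q := by
    rw [hQ, Polynomial.map_prod]
    simp only [Polynomial.map_sub, map_X, map_C]
    conv_rhs => rw [← hOimg]
    rw [Finset.prod_image fun _ _ _ _ h => RingHom.injective _ h]
  -- The set of conjugates is stable under `rotate ζ`, so `Q` descends to a divisor of `P`.
  have hlift : Q ∈ lifts (substPow (k := k) m) := by
    rw [lifts_iff_coeff_lifts]
    intro j
    refine mem_range_substPow_of_rotate m ζ hζ _ ?_
    rw [← coeff_map, hQfix]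
  obtain ⟨Q₀, hQ₀map, hQ₀deg, hQ₀m⟩ := lifts_and_natDegree_eq_and_monic hlift hQmonic
  have hQdvd : Q ∣ substCurve m P := by
    have hle : O.val ≤ (substCurve m P).roots := by
      rw [Multiset.le_iff_subset O.nodup]
      intro w hw
      obtain ⟨i, -, rfl⟩ := Finset.mem_image.1 (show w ∈ O from hw)
      refine (mem_roots (hm.map _).ne_zero).2 ?_
      change (substCurve m P).eval _ = 0
      rw [rotate_iterate, substCurve_eval_rotate, hz, map_zero]
      rw [pow_right_comm, hζ.pow_eq_one, one_pow]
    exact (Multiset.prod_X_sub_C_dvd_iff_le_roots (hm.map _).ne_zero _).2 hle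
  rw [← hQ₀map, substCurve, map_dvd_map' ] at hQdvd
  have hQdeg : Q.natDegree ≠ 0 := by
    rw [hQ, natDegree_prod_of_monic _ _ fun w _ => monic_X_sub_C w]
    simp only [natDegree_X_sub_C, Finset.sum_const, smul_eq_mul, mul_one]
    exact (Finset.card_pos.2 ⟨_, hOmem 0⟩).ne'
  have hnu : ¬ IsUnit Q₀ := fun h => hQdeg (by rw [← hQ₀deg, natDegree_eq_zero_of_isUnit h])
  have hass : Associated Q₀ P := (hP.dvd_iff.1 hQdvd).resolve_left hnu |>.symm
  rw [← eq_of_monic_of_associated hQ₀m hm hass, substCurve, hQ₀map]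

theorem natDegree_eq_minimalPeriod {P : Curve k} (hP : Irreducible P) (hm : P.Monic) (m : ℕ+)
    (ζ : kˣ) (hζ : IsPrimitiveRoot ζ m) (z : LaurentSeries k) (hz : (substCurve m P).eval z = 0) :
    P.natDegree = Function.minimalPeriod (rotate ζ) z := by
  have h := congrArg natDegree (substCurve_eq_prod_conjugates hP hm m ζ hζ z hz)
  rw [substCurve, hm.natDegree_map, natDegree_prod_of_monic _ _ fun w _ => monic_X_sub_C _] at h
  simpa using h

theorem exists_isPrimitiveRoot_units [IsAlgClosed k] [CharZero k] (m : ℕ+) :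
    ∃ ζ : kˣ, IsPrimitiveRoot ζ m := by
  have : NeZero ((m : ℕ) : k) := ⟨Nat.cast_ne_zero.2 m.ne_zero⟩
  obtain ⟨ζ, hζ⟩ := HasEnoughRootsOfUnity.exists_primitiveRoot k (m : ℕ)
  exact ⟨hζ.isUnit m.ne_zero |>.unit, hζ.isUnit_unit m.ne_zero⟩

/-- An irreducible polynomial of degree `n` acquires a root already after `X ↦ X ^ n`. -/
theorem exists_root_substCurve_natDegree [IsAlgClosed k] [CharZero k] {P : Curve k}
    (hP : Irreducible P) (hm : P.Monic) (n : ℕ+) (hn : (n : ℕ) = P.natDegree) :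
    ∃ z : LaurentSeries k, (substCurve n P).eval z = 0 := by
  obtain ⟨ν, z, hz⟩ := exists_root_substCurve P hm (hn ▸ n.pos)
  obtain ⟨ζ, hζ⟩ := exists_isPrimitiveRoot_units (k := k) ν
  have hd := natDegree_eq_minimalPeriod hP hm ν ζ hζ z hz
  rw [← hn] at hd
  have hper : Function.IsPeriodicPt (rotate ζ) ν z := by
    rw [Function.IsPeriodicPt, Function.IsFixedPt, rotate_iterate, hζ.pow_eq_one, rotate_one]
  obtain ⟨e, he⟩ : (n : ℕ) ∣ ν := hd ▸ hper.minimalPeriod_dvd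
  have he0 : 0 < e := Nat.pos_of_ne_zero fun h => ν.ne_zero (by rw [he, h, mul_zero])
  have hfix : rotate (ζ ^ (n : ℕ)) z = z := by
    rw [← rotate_iterate, hd]
    exact Function.iterate_minimalPeriod
  -- The stabilizer of `z` has order `ν / n`, so that `z` is a series in `X ^ (ν / n)`.
  obtain ⟨w, rfl⟩ := mem_range_substPow_of_rotate ⟨e, he0⟩ _ (hζ.pow ν.pos he) z hfix
  refine ⟨w, substPow_injective ⟨e, he0⟩ ?_⟩
  rw [← substCurve_eval_substPow ⟨e, he0⟩ n ν (by rw [he, mul_comm]; rfl), hz, map_zero]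

/-- All values `H(X ^ ν, w(X))` at roots `w` of `P(X ^ ν, Y)`, for `P` irreducible, have the same
order, and it is proportional to `ν`. -/
theorem orderTop_eval_root [IsAlgClosed k] [CharZero k] {P : Curve k}
    (hP : Irreducible P) (hm : P.Monic) (m n ν : ℕ+) (hν : (ν : ℕ) = m * n) (z : LaurentSeries k)
    (hz : (substCurve n P).eval z = 0) (H : Curve k) (w : LaurentSeries k)
    (hw : w ∈ (substCurve ν P).roots) :
    ((substCurve ν H).eval w).orderTop =
      ((substCurve n H).eval z).orderTop.map (fun i => ((m : ℕ) : ℤ) * i) := by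
  obtain ⟨ζ, hζ⟩ := exists_isPrimitiveRoot_units (k := k) ν
  have hz' : (substCurve ν P).eval (substPow m z) = 0 := by
    rw [substCurve_eval_substPow m n ν hν, hz, map_zero]
  have hw' := isRoot_of_mem_roots hw
  rw [substCurve_eq_prod_conjugates hP hm ν ζ hζ _ hz', IsRoot, eval_prod,
    Finset.prod_eq_zero_iff] at hw'
  obtain ⟨i, -, hi⟩ := hw'
  rw [eval_sub, eval_X, eval_C, sub_eq_zero] at hi
  rw [hi, rotate_iterate, substCurve_eval_rotate, orderTop_rotate,
    substCurve_eval_substPow m n ν hν, orderTop_substPow]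
  rw [pow_right_comm, hζ.pow_eq_one, one_pow]

theorem card_roots_substCurve [IsAlgClosed k] [CharZero k] {P : Curve k}
    (hP : Irreducible P) (hm : P.Monic) (m n ν : ℕ+) (hν : (ν : ℕ) = m * n) (z : LaurentSeries k)
    (hz : (substCurve n P).eval z = 0) : (substCurve ν P).roots.card = P.natDegree := by
  obtain ⟨ζ, hζ⟩ := exists_isPrimitiveRoot_units (k := k) ν
  have hz' : (substCurve ν P).eval (substPow m z) = 0 := by
    rw [substCurve_eval_substPow m n ν hν, hz, map_zero]
  rw [natDegree_eq_minimalPeriod hP hm ν ζ hζ _ hz',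
    substCurve_eq_prod_conjugates hP hm ν ζ hζ _ hz']
  have := roots_multiset_prod_X_sub_C ((Multiset.range (Function.minimalPeriod (rotate ζ)
    (substPow m z))).map fun i => (rotate ζ)^[i] (substPow m z))
  rw [Multiset.map_map] at this
  rw [Finset.prod, Finset.range_val]
  exact (congrArg Multiset.card this).trans (by simp)

theorem irreducible_of_mem_branches {F P : Curve k} (h : P ∈ branches F) : Irreducible P := by
  classical exact irreducible_of_normalized_factor P h

theorem monic_of_mem_branches {F P : Curve k} (h : P ∈ branches F) : P.Monic := by
  classical
  rw [← normalize_normalized_factor P h]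
  exact monic_normalize (irreducible_of_mem_branches h).ne_zero

theorem branches_eq_singleton {P : Curve k} (hP : Irreducible P) (hm : P.Monic) :
    branches P = {P} := by
  classical
  rw [branches, normalizedFactors_irreducible hP, hm.normalize_eq_self]

theorem leadingCoeff_mul_prod_branches (F : Curve k) :
    C F.leadingCoeff * (branches F).prod = F := by
  classical exact leadingCoeff_mul_prod_normalizedFactors F

theorem coe_ramIndex {P : Curve k} (hP : Irreducible P) (hm : P.Monic) :
    (ramIndex P : ℕ) = P.natDegree := by
  simp [ramIndex, branches_eq_singleton hP hm]

theorem natDegree_dvd_ramIndex {F P : Curve k} (h : P ∈ branches F) :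
    P.natDegree ∣ (ramIndex F : ℕ) :=
  Multiset.dvd_lcm (Multiset.mem_map_of_mem _ h)

theorem mem_puiseuxRoots {P : Curve k} (hP : P ≠ 0) (z : LaurentSeries k) :
    z ∈ puiseuxRoots P ↔ (substCurve (ramIndex P) P).eval z = 0 := by
  rw [puiseuxRoots, substCurve, mem_roots ((Polynomial.map_ne_zero_iff (substPow_injective _)).2 hP), IsRoot]

theorem exists_mem_puiseuxRoots [IsAlgClosed k] [CharZero k] {P : Curve k}
    (hP : Irreducible P) (hm : P.Monic) : ∃ z, z ∈ puiseuxRoots P := by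
  simp only [mem_puiseuxRoots hm.ne_zero]
  exact exists_root_substCurve_natDegree hP hm _ (coe_ramIndex hP hm)

/-- The contribution of a branch `P` of `F` to `int(F, H)` is the order of `H` along the
parametrization of `P` given by any one of its roots. -/
theorem sum_ordX_branch [IsAlgClosed k] [CharZero k] {P : Curve k}
    (hP : Irreducible P) (hm : P.Monic) (ν : ℕ+) (hν : P.natDegree ∣ (ν : ℕ)) (z : LaurentSeries k)
    (hz : z ∈ puiseuxRoots P) (H : Curve k) :
    ((substCurve ν P).roots.map fun w =>
      (ordX ((substCurve ν H).eval w)).map fun q : ℚ => q / (ν : ℕ)).sum =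
      ordX (valueAt P H z) := by
  obtain ⟨m, hmν⟩ := hν
  rw [← coe_ramIndex hP hm, mul_comm] at hmν
  have hm0 : 0 < m := Nat.pos_of_ne_zero fun h => ν.ne_zero (by rw [hmν, h, zero_mul])
  lift m to ℕ+ using hm0
  rw [mem_puiseuxRoots hm.ne_zero] at hz
  have hcongr : ∀ w ∈ (substCurve ν P).roots,
      (ordX ((substCurve ν H).eval w)).map (fun q : ℚ => q / (ν : ℕ)) =
        (ordX (valueAt P H z)).map (fun q : ℚ => q / P.natDegree) := by
    intro w hw
    rw [ordX, orderTop_eval_root hP hm m _ ν hmν z hz H w hw, ordX, valueAt]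
    induction ((substCurve (ramIndex P) H).eval z).orderTop using WithTop.recTopCoe with
    | top => rfl
    | coe i =>
      simp only [WithTop.map_coe]
      congr 1
      rw [hmν, ← coe_ramIndex hP hm]
      have h1 : ((m : ℕ) : ℚ) ≠ 0 := Nat.cast_ne_zero.2 m.ne_zero
      push_cast
      rw [mul_div_mul_left _ _ h1]
  rw [Multiset.map_congr rfl hcongr, Multiset.map_const', Multiset.sum_replicate,
    card_roots_substCurve hP hm m _ ν hmν z hz]
  have hn := hP.natDegree_pos
  induction ordX (valueAt P H z) using WithTop.recTopCoe with
  | top =>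
    rw [WithTop.map_top]
    obtain ⟨n, hn'⟩ := Nat.exists_eq_succ_of_ne_zero hn.ne'
    rw [hn', succ_nsmul, add_top]
  | coe q =>
    rw [WithTop.map_coe, ← WithTop.coe_nsmul, nsmul_eq_mul, mul_div_cancel₀]
    exact Nat.cast_ne_zero.2 hn.ne'

/-- For `k`-monic `F`, the intersection multiplicity `int(F, H)` is the sum over the branches of
`F` of the orders of `H` along their parametrizations. -/
theorem inter_eq_sum_branches [IsAlgClosed k] [CharZero k] {F : Curve k} (hF : IsKMonic F)
    (z : Curve k → LaurentSeries k) (hz : ∀ P ∈ branches F, z P ∈ puiseuxRoots P) (H : Curve k) :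
    inter F H = ((branches F).map fun P => ordX (valueAt P H (z P))).sum := by
  classical
  obtain ⟨c, hc, hlc⟩ := hF
  have hF0 : F ≠ 0 := by
    rintro rfl
    rw [leadingCoeff_zero] at hlc
    exact hc (HahnSeries.C_injective (by rw [← hlc, map_zero]))
  have hprod := leadingCoeff_mul_prod_branches F
  by_cases hH : H = 0
  · subst hH
    rw [inter, if_neg (by simp)]
    by_cases hd : F.natDegree = 0
    · rw [if_pos (Or.inr ⟨rfl, hF0, hd⟩)]
      have : branches F = 0 := by
        refine Multiset.eq_zero_of_forall_notMem fun P hP => ?_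
        have h1 := natDegree_le_of_dvd (dvd_of_mem_normalizedFactors hP) hF0
        have h2 := natDegree_pos_of_mem_branches hP
        omega
      rw [this, Multiset.map_zero, Multiset.sum_zero]
    · rw [if_neg (by simp [hF0, hd])]
      obtain ⟨P, hP⟩ : ∃ P, P ∈ branches F := by
        refine Multiset.exists_mem_of_ne_zero fun h => hd ?_
        rw [← hprod, h, Multiset.prod_zero, mul_one, natDegree_C]
      rw [← Multiset.cons_erase hP, Multiset.map_cons, Multiset.sum_cons]
      simp [valueAt, substCurve, ordX]
  · rw [inter, if_pos ⟨hF0, hH⟩, hlc, substPow_C, HahnSeries.order_C, Int.cast_zero, mul_zero,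
      WithTop.coe_zero, zero_add]
    have hmap : ∀ s : Multiset (WithTop ℚ), s.sum.map (fun q : ℚ => q / (ramIndex F : ℕ)) =
        (s.map fun x => x.map (fun q : ℚ => q / (ramIndex F : ℕ))).sum := fun s => by
      simp only [div_eq_mul_inv]
      exact map_multiset_sum (AddMonoidHom.withTopMap
        (AddMonoidHom.mulRight (((ramIndex F : ℕ) : ℚ)⁻¹))) s
    rw [hmap, Multiset.map_map, puiseuxRoots]
    have hroots : (substCurve (ramIndex F) F).roots =
        (branches F).bind fun P => (substCurve (ramIndex F) P).roots := by
      have hmapF : ∀ m, substCurve m F = C (HahnSeries.C c) *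
          ((branches F).map fun P => substCurve m P).prod := fun m => by
        conv_lhs => rw [substCurve, ← hprod]
        rw [Polynomial.map_mul, map_C, Polynomial.map_multiset_prod, hlc, substPow_C]
        rfl
      rw [hmapF, roots_C_mul _ (by simpa using hc), roots_multiset_prod, Multiset.bind_map]
      intro h0
      obtain ⟨P, hP, hP0⟩ := Multiset.mem_map.1 h0
      exact ((monic_of_mem_branches hP).map _).ne_zero hP0
    rw [hroots, Multiset.map_bind, Multiset.sum_bind]
    refine congrArg _ (Multiset.map_congr rfl fun P hP => ?_)
    exact sum_ordX_branch (irreducible_of_mem_branches hP) (monic_of_mem_branches hP) _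
      (natDegree_dvd_ramIndex hP) (z P) (hz P hP) H

/-! ### The beta-jacobian identity -/

theorem valueAt_sub_const (P G : Curve k) (c : k) (z : LaurentSeries k) :
    valueAt P (G - const c) z = valueAt P G z - HahnSeries.C c := by
  rw [valueAt, valueAt, substCurve, const, Polynomial.map_sub, map_C, substPow_C, eval_sub, eval_C]
  rfl

theorem ordX_eq_coe_iff (f : LaurentSeries k) (n : ℤ) :
    ordX f = ((n : ℚ) : WithTop ℚ) ↔ f.orderTop = (n : WithTop ℤ) := by
  rw [ordX]
  induction f.orderTop using WithTop.recTopCoe with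
  | top => simp
  | coe i => simp

theorem ordX_pos_iff (f : LaurentSeries k) : 0 < ordX f ↔ 0 < f.orderTop := by
  rw [ordX]
  induction f.orderTop using WithTop.recTopCoe with
  | top => simp
  | coe i => simp [-WithTop.coe_zero]

/-- Along a parametrized root of `E`, the Jacobian of `E` and `G` is, up to the factor `E_Y`
and a power of `X`, the derivative of `G` along that root. -/
theorem single_mul_valueAt_jacobian (P E G : Curve k) (z : LaurentSeries k)
    (hE : valueAt P E z = 0) :
    HahnSeries.single ((ramIndex P : ℕ) : ℤ) ((ramIndex P : ℕ) : k) *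
        valueAt P (jacobian E G) z =
      - (valueAt P (derivY E) z *
        (HahnSeries.single 1 1 * LaurentSeries.derivative k (valueAt P G z))) := by
  have hX : ∀ H : Curve k,
      HahnSeries.single 1 1 * (derivX (substCurve (ramIndex P) H)).eval z =
        HahnSeries.single ((ramIndex P : ℕ) : ℤ) ((ramIndex P : ℕ) : k) *
          valueAt P (derivX H) z := fun H => by
    have := congrArg (eval z) (single_mul_derivX_substCurve (ramIndex P) H)
    rwa [eval_mul, eval_C, eval_mul, eval_C] at this
  have hY : ∀ H : Curve k, (derivY (substCurve (ramIndex P) H)).eval z =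
      valueAt P (derivY H) z := fun H => by
    rw [valueAt, derivY, derivY, substCurve, substCurve, derivative_map]
  have h1 := derivative_eval (substCurve (ramIndex P) E) z
  have h2 := derivative_eval (substCurve (ramIndex P) G) z
  rw [hY] at h1 h2
  rw [valueAt] at hE
  rw [hE, map_zero] at h1
  have h3 := hX E
  have h4 := hX G
  have hJ : valueAt P (jacobian E G) z = valueAt P (derivX E) z * valueAt P (derivY G) z -
      valueAt P (derivY E) z * valueAt P (derivX G) z := by
    simp [valueAt, substCurve, jacobian]
  rw [hJ]
  change _ = - (_ * (_ * LaurentSeries.derivative k ((substCurve (ramIndex P) G).eval z)))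
  rw [h2]
  linear_combination (-valueAt P (derivY G) z) * h3 + valueAt P (derivY E) z * h4 -
    HahnSeries.single 1 1 * valueAt P (derivY G) z * h1

open Classical in
theorem rad_eq (F : Curve k) : rad F = C F.leadingCoeff * radical F := by
  rw [rad, radical, ← toFinset_normalizedFactors]
  rfl

theorem valueAt_eq_zero_of_dvd {P E : Curve k} (hP : P ≠ 0) (h : P ∣ E) {z : LaurentSeries k}
    (hz : z ∈ puiseuxRoots P) : valueAt P E z = 0 := by
  obtain ⟨Q, rfl⟩ := h
  rw [mem_puiseuxRoots hP] at hz
  rw [valueAt, substCurve, Polynomial.map_mul, eval_mul]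
  rw [substCurve] at hz
  rw [hz, zero_mul]

theorem dvd_rad {F P : Curve k} (hP : P ∈ branches F) : P ∣ rad F := by
  classical
  rw [rad]
  refine dvd_mul_of_dvd_right (Finset.dvd_prod_of_mem id ?_) _
  exact Multiset.mem_toFinset.2 hP

theorem valueAt_derivY_rad_ne_zero [CharZero k] {F P : Curve k} (hF : F ≠ 0)
    (hP : P ∈ branches F) {z : LaurentSeries k} (hz : z ∈ puiseuxRoots P) :
    valueAt P (derivY (rad F)) z ≠ 0 := by
  classical
  have := charZero_laurentSeries (k := k)
  have hsep : (radical F).Separable := PerfectField.separable_iff_squarefree.2 squarefree_radical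
  have hE : valueAt P (rad F) z = 0 :=
    valueAt_eq_zero_of_dvd (irreducible_of_mem_branches hP).ne_zero (dvd_rad hP) hz
  have hl : (substPow (ramIndex P)) F.leadingCoeff ≠ 0 :=
    (_root_.map_ne_zero _).2 (leadingCoeff_ne_zero.2 hF)
  rw [rad_eq, valueAt, substCurve, Polynomial.map_mul, map_C, eval_mul, eval_C] at hE
  rw [rad_eq, valueAt, substCurve, derivY, derivative_C_mul, Polynomial.map_mul, map_C, eval_mul,
    eval_C]
  refine mul_ne_zero hl fun h => ?_
  have hcop := (hsep.map (f := substPow (ramIndex P)))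
  rw [Separable, derivative_map] at hcop
  obtain ⟨a, b, hab⟩ := hcop
  have := congrArg (eval z) hab
  rw [eval_add, eval_mul, eval_mul, h, (mul_eq_zero.1 hE).resolve_left hl] at this
  simp at this

theorem eq_of_orderTop_sub_C_pos {f : LaurentSeries k} {c d : k}
    (hc : 0 < (f - HahnSeries.C c).orderTop) (hd : 0 < (f - HahnSeries.C d).orderTop) : c = d := by
  have h1 := HahnSeries.coeff_eq_zero_of_lt_orderTop hc
  have h2 := HahnSeries.coeff_eq_zero_of_lt_orderTop hd
  simp [HahnSeries.C_apply] at h1 h2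
  rw [sub_eq_zero] at h1 h2
  rw [← h1, h2]

/-- The residue of `G` along a branch may be tested on any one root of the branch. -/
theorem residue_eq_coe_iff [IsAlgClosed k] [CharZero k] {P : Curve k}
    (hP : Irreducible P) (hm : P.Monic) (G : Curve k) {z : LaurentSeries k}
    (hz : z ∈ puiseuxRoots P) (c : k) :
    residue P G = (c : WithTop k) ↔ 0 < (valueAt P G z - HahnSeries.C c).orderTop := by
  have hall : ∀ c : k, (∀ w ∈ puiseuxRoots P, 0 < ordX (valueAt P G w - HahnSeries.C c)) ↔
      0 < (valueAt P G z - HahnSeries.C c).orderTop := fun c => by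
    simp only [ordX_pos_iff]
    refine ⟨fun h => h z hz, fun h w hw => ?_⟩
    have := orderTop_eval_root hP hm 1 (ramIndex P) (ramIndex P) (by simp) z
      ((mem_puiseuxRoots hm.ne_zero z).1 hz) (G - const c) w hw
    rw [← valueAt_sub_const] at h ⊢
    rw [valueAt, this]
    change 0 < (valueAt P (G - const c) z).orderTop.map _
    generalize (valueAt P (G - const c) z).orderTop = x at h ⊢
    induction x using WithTop.recTopCoe with
    | top => exact h
    | coe x => simpa using h
  rw [residue]
  split_ifs with h
  · rw [WithTop.coe_inj]
    have hs := (hall _).1 h.choose_spec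
    exact ⟨fun hc => hc ▸ hs, fun hc => eq_of_orderTop_sub_C_pos hs hc⟩
  · exact ⟨fun hc => absurd hc WithTop.top_ne_coe, fun hc => absurd ⟨c, (hall c).2 hc⟩ h⟩

open Classical in
/-- The beta invariant as a sum over branches instead of over residues. -/
theorem beta_eq_sum_branches (F G : Curve k) :
    beta F G = ((branches F).map fun P => ∑ c ∈ (alpha_finite F G).toFinset.erase 0,
      if residue P G = (c : WithTop k) then inter P (G - const c) else 0).sum := by
  have h : ∀ c, betaAt c F G = ((branches F).map fun P =>
      if residue P G = (c : WithTop k) then inter P (G - const c) else 0).sum := fun c => by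
    rw [betaAt, alphaAt]
    induction branches F using Multiset.induction_on with
    | empty => simp
    | cons P s ih =>
      rw [Multiset.map_cons, Multiset.sum_cons, ← ih]
      by_cases hc : residue P G = (c : WithTop k) <;> simp [hc]
  rw [beta, Finset.sum_congr rfl fun c _ => h c]
  exact Multiset.sum_map_sum_map _ _

open Classical in
/-- The local identity along one branch: the order of the derivative of `G` along the branch
falls short of the order of `G` by the order of the parameter, unless `G` has a nonzero residue,
which then contributes its beta invariant. -/
theorem branch_identity [IsAlgClosed k] [CharZero k] {F G P : Curve k} (hF : F ≠ 0)
    (hP : P ∈ branches F) {z : LaurentSeries k} (hz : z ∈ puiseuxRoots P)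
    (hG : ∀ c : k, valueAt P (G - const c) z ≠ 0) :
    ∃ j i e b : ℤ, ordX (valueAt P (jacobian (rad F) G) z) = ((j : ℚ) : WithTop ℚ) ∧
      ordX (valueAt P G z) = ((i : ℚ) : WithTop ℚ) ∧
      ordX (valueAt P (derivY (rad F)) z) = ((e : ℚ) : WithTop ℚ) ∧
      (∑ c ∈ (alpha_finite F G).toFinset.erase 0,
        if residue P G = (c : WithTop k) then inter P (G - const c) else 0) =
          ((b : ℚ) : WithTop ℚ) ∧
      j = i + e - P.natDegree + b := by
  have hirr := irreducible_of_mem_branches hP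
  have hm := monic_of_mem_branches hP
  simp only [valueAt_sub_const] at hG
  simp only [ordX_eq_coe_iff]
  set g := valueAt P G z with hg
  have hjac := single_mul_valueAt_jacobian P (rad F) G z
    (valueAt_eq_zero_of_dvd hirr.ne_zero (dvd_rad hP) hz)
  rw [← hg] at hjac
  have hE := valueAt_derivY_rad_ne_zero hF hP hz
  obtain ⟨e, he⟩ := WithTop.ne_top_iff_exists.1 (HahnSeries.orderTop_ne_top.2 hE)
  have hg0 : g ≠ 0 := by simpa using hG 0
  obtain ⟨i, hi⟩ := WithTop.ne_top_iff_exists.1 (HahnSeries.orderTop_ne_top.2 hg0)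
  -- It suffices to find `b` with `ord (X g') = i + b`.
  suffices hsuff : ∃ b : ℤ, (∑ c ∈ (alpha_finite F G).toFinset.erase 0,
        if residue P G = (c : WithTop k) then inter P (G - const c) else 0) =
          ((b : ℚ) : WithTop ℚ) ∧
      (HahnSeries.single 1 1 * LaurentSeries.derivative k g : LaurentSeries k).orderTop =
        ((i + b : ℤ) : WithTop ℤ) by
    obtain ⟨b, hb, hb'⟩ := hsuff
    refine ⟨i + e - P.natDegree + b, i, e, b, ?_, hi.symm, he.symm, hb, rfl⟩
    have := congrArg HahnSeries.orderTop hjac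
    rw [HahnSeries.orderTop_neg, HahnSeries.orderTop_mul, HahnSeries.orderTop_mul,
      HahnSeries.orderTop_single (Nat.cast_ne_zero.2 (ramIndex P).ne_zero), hb', ← he,
      coe_ramIndex hirr hm] at this
    generalize (valueAt P (jacobian (rad F) G) z).orderTop = x at this
    induction x using WithTop.recTopCoe with
    | top => exact absurd this (by rw [WithTop.add_top, ← WithTop.coe_add]; exact WithTop.top_ne_coe)
    | coe x =>
      rw [← WithTop.coe_add, ← WithTop.coe_add, WithTop.coe_inj] at this
      rw [WithTop.coe_inj]
      linarith
  have hres := residue_eq_coe_iff hirr hm G hz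
  rw [← hg] at hres
  by_cases hi0 : i = 0
  · -- The residue is the constant term `l` of `g`, and subtracting it does not change `g'`.
    set l := g.coeff 0 with hl
    have hl0 : l ≠ 0 := HahnSeries.coeff_orderTop_ne (by rw [← hi, hi0])
    have hpos : 0 < (g - HahnSeries.C l).orderTop := by
      by_contra hle
      obtain ⟨n, hn⟩ := WithTop.ne_top_iff_exists.1 (HahnSeries.orderTop_ne_top.2 (hG l))
      rw [← hn] at hle
      have hn0 : n ≤ 0 := by exact_mod_cast not_lt.1 hle
      refine HahnSeries.coeff_orderTop_ne hn.symm ?_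
      rw [HahnSeries.coeff_sub, HahnSeries.C_apply]
      rcases hn0.lt_or_eq with h | rfl
      · rw [HahnSeries.coeff_single_of_ne h.ne, sub_zero]
        exact HahnSeries.coeff_eq_zero_of_lt_orderTop (by rw [← hi, hi0]; exact_mod_cast h)
      · rw [HahnSeries.coeff_single_same, sub_self]
    have hlres : residue P G = (l : WithTop k) := (hres l).2 hpos
    obtain ⟨b, hb⟩ := WithTop.ne_top_iff_exists.1 (HahnSeries.orderTop_ne_top.2 (hG l))
    refine ⟨b, ?_, ?_⟩
    · have hmem : l ∈ (alpha_finite F G).toFinset.erase 0 := by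
        rw [Finset.mem_erase, Set.Finite.mem_toFinset]
        refine ⟨hl0, fun h => ?_⟩
        have : P ∈ alphaAt l F G := Multiset.mem_filter.2 ⟨hP, hlres⟩
        rw [h] at this
        exact absurd this (Multiset.notMem_zero P)
      rw [Finset.sum_eq_single_of_mem l hmem, if_pos hlres]
      · rw [inter_eq_sum_branches ⟨1, one_ne_zero, by rw [hm.leadingCoeff, map_one]⟩ (fun _ => z)
          (fun Q hQ => ?_), branches_eq_singleton hirr hm, Multiset.map_singleton,
          Multiset.sum_singleton, valueAt_sub_const, ordX_eq_coe_iff, ← hg, hb]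
        rw [branches_eq_singleton hirr hm, Multiset.mem_singleton] at hQ
        rwa [hQ]
      · intro c _ hcl
        rw [if_neg]
        rw [hlres, WithTop.coe_inj]
        exact hcl.symm
    · rw [← sub_zero (LaurentSeries.derivative k g), ← derivative_C l, ← map_sub, hi0, zero_add]
      refine orderTop_single_one_mul_derivative _ b hb.symm ?_
      rw [← hb] at hpos
      rintro rfl
      exact lt_irrefl _ hpos
  · refine ⟨0, ?_, ?_⟩
    · rw [Int.cast_zero, WithTop.coe_zero]
      refine Finset.sum_eq_zero fun c hc => if_neg fun h => ?_
      have hc0 := (Finset.mem_erase.1 hc).1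
      have h1 := (hres c).1 h
      have h2 := HahnSeries.coeff_eq_zero_of_lt_orderTop h1
      rw [HahnSeries.coeff_sub, HahnSeries.C_apply, HahnSeries.coeff_single_same, sub_eq_zero] at h2
      have h3 : i ≤ 0 := by
        have := HahnSeries.orderTop_le_of_coeff_ne_zero (h2.trans_ne hc0)
        rw [← hi] at this
        exact_mod_cast this
      have h4 := HahnSeries.coeff_eq_zero_of_lt_orderTop
        (lt_of_le_of_lt (by exact_mod_cast h3 : (i : WithTop ℤ) ≤ 0) h1)
      rw [HahnSeries.coeff_sub, HahnSeries.C_apply, HahnSeries.coeff_single_of_ne hi0,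
        sub_zero] at h4
      exact HahnSeries.coeff_orderTop_ne hi.symm h4
    · rw [add_zero]
      exact orderTop_single_one_mul_derivative g i hi.symm hi0

theorem sum_map_coe_intCast {ι : Type*} (s : Multiset ι) (f : ι → WithTop ℚ) (g : ι → ℤ)
    (h : ∀ x ∈ s, f x = ((g x : ℚ) : WithTop ℚ)) :
    (s.map f).sum = (((s.map g).sum : ℤ) : ℚ) := by
  induction s using Multiset.induction_on with
  | empty => simp
  | cons a s ih =>
    rw [Multiset.map_cons, Multiset.sum_cons, Multiset.map_cons, Multiset.sum_cons,
      h a (Multiset.mem_cons_self a s), ih fun x hx => h x (Multiset.mem_cons_of_mem hx)]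
    push_cast
    rfl

theorem natDegree_eq_sum_branches {F : Curve k} (hF : F ≠ 0) :
    F.natDegree = ((branches F).map natDegree).sum := by
  conv_lhs => rw [← leadingCoeff_mul_prod_branches F]
  rw [natDegree_C_mul (leadingCoeff_ne_zero.2 hF), natDegree_multiset_prod_of_monic _
    fun P hP => monic_of_mem_branches hP]

end MeroCurve

end

theorem mainTheorem1 {k : Type*} [Field k] [IsAlgClosed k] [CharZero k]
    (F G : MeroCurve.Curve k) (N : ℕ) (hF : MeroCurve.IsKMonic F) (hN : F.natDegree = N)
    (hG : ∀ c : k, MeroCurve.GcdOne F (G - MeroCurve.const c)) :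
    ∃ j i e b : ℤ,
      MeroCurve.inter F (MeroCurve.jacobian (MeroCurve.rad F) G) = ((j : ℚ) : WithTop ℚ) ∧
      MeroCurve.inter F G = ((i : ℚ) : WithTop ℚ) ∧
      MeroCurve.inter F (MeroCurve.derivY (MeroCurve.rad F)) = ((e : ℚ) : WithTop ℚ) ∧
      MeroCurve.beta F G = ((b : ℚ) : WithTop ℚ) ∧
      j = i + e - (N : ℤ) + b := by
  classical
  have hF0 : F ≠ 0 := by
    obtain ⟨c, hc, hlc⟩ := hF
    rintro rfl
    rw [leadingCoeff_zero] at hlc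
    exact hc (HahnSeries.C_injective (by rw [← hlc, map_zero]))
  have hex : ∀ P ∈ MeroCurve.branches F, ∃ z, z ∈ MeroCurve.puiseuxRoots P := fun P hP =>
    MeroCurve.exists_mem_puiseuxRoots (MeroCurve.irreducible_of_mem_branches hP)
      (MeroCurve.monic_of_mem_branches hP)
  choose! z hz using hex
  have hval : ∀ P ∈ MeroCurve.branches F, ∀ c : k,
      MeroCurve.valueAt P (G - MeroCurve.const c) (z P) ≠ 0 := by
    intro P hP c h
    apply hG c
    rw [MeroCurve.inter_eq_sum_branches hF z hz, ← Multiset.cons_erase hP, Multiset.map_cons,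
      Multiset.sum_cons, h]
    simp [MeroCurve.ordX]
  have hloc := fun P hP => MeroCurve.branch_identity hF0 hP (hz P hP) (hval P hP)
  choose! j i e b hj hi he hb hjieb using hloc
  let s := MeroCurve.branches F
  refine ⟨(s.map j).sum, (s.map i).sum, (s.map e).sum, (s.map b).sum, ?_, ?_, ?_, ?_, ?_⟩
  · rw [MeroCurve.inter_eq_sum_branches hF z hz]
    exact MeroCurve.sum_map_coe_intCast _ _ _ hj
  · rw [MeroCurve.inter_eq_sum_branches hF z hz]
    exact MeroCurve.sum_map_coe_intCast _ _ _ hi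
  · rw [MeroCurve.inter_eq_sum_branches hF z hz]
    exact MeroCurve.sum_map_coe_intCast _ _ _ he
  · rw [MeroCurve.beta_eq_sum_branches]
    exact MeroCurve.sum_map_coe_intCast _ _ _ hb
  · rw [← hN, MeroCurve.natDegree_eq_sum_branches hF0, Multiset.map_congr rfl hjieb,
      Multiset.sum_map_add, Multiset.sum_map_sub, Multiset.sum_map_add, Nat.cast_multiset_sum,
      Multiset.map_map]
    rfl
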